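/- All Banach spaces are real; $E^*$ is the dual of $E$, $B_E$ its closed unit ball, and $p^*$ denotes the conjugate exponent, $\frac1p+\frac1{p^*}=1$ (so $\infty^*=1$). For $0<p\le\infty$, $\|\cdot\|_p$ is the $\ell_p$ (quasi-)norm of a finite sequence of reals. Let $X$ be a pointed metric space with base point $0$ and let $E,F$ be Banach spaces. $LipL_0(X\times E;F)$ is the space of all maps $T:X\times E\to F$ such that $T(x,\cdot)$ is linear for every $x\in X$, $T(0,e)=0$ for every $e\in E$, and for some constant $C$ $$\|T(x,e)-T(y,e)\|\le C\,d(x,y)\,\|e\|\qquad(x,y\in X,\ e\in E).$$ With the norm $LipL(T)$, the infimum of such $C\ge 0$, it is a Banach space. Write $LipL_0(X\times E)=LipL_0(X\times E;\mathbb R)$. The transpose $T^t:F^*\to LipL_0(X\times E)$ of $T$ is the bounded linear operator $T^t(z^*)(x,e)=\langle z^*,T(x,e)\rangle$. $T\in LipL_0(X\times E;F)$ is *Cohen strongly $p$-summing*, $T\in\mathcal D_p^{LipL}(X\times E;F)$, if there is $C\ge 0$ such that for all $n$ and all $x_i,y_i\in X$, $e_i\in E$, $z_i^*\in F^*$ ($1\le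 i\le n$) $$\sum_{i=1}^n|\langle T(x_i,e_i)-T(y_i,e_i),z_i^*\rangle|\le C\,\big\|(d(x_i,y_i)\|e_i\|)_{i}\big\|_p\ \sup_{z^{**}\in B_{F^{**}}}\big\|(z^{**}(z_i^*))_{i}\big\|_{p^*};$$ $d_p^{LipL}(T)$ is the infimum of such $C$. A bounded linear operator $u:G\to H$ between Banach spaces is *absolutely $q$-summing*, $u\in\Pi_q(G;H)$, if there is $C\ge 0$ such that $\|(\|u(g_i)\|)_i\|_q\le C\sup_{\varphi\in B_{G^*}}\|(\varphi(g_i))_i\|_q$ for all finite sequences $(g_i)$ in $G$; $\pi_q(u)$ is the infimum of such $C$. For a class $\mathcal I$ of bounded linear operators between Banach spaces with a norm $\|\cdot\|_{\mathcal I}$, let $\mathcal I^{LipL}_{dual}(X\times E;F)=\{T\in LipL_0(X\times E;F):T^t\in\mathcal I(F^*;LipL_0(X\times E))\}$, with $\|T\|_{\mathcal I^{LipL}_{dual}}=\|T^t\|_{\mathcal I}$. A *Banach Lip-linear ideal* is a class $\mathcal I^{LipL}$ of such operators $T$ (for all $X,E,F$), with a function $\|\cdot\|_{\mathcal I^{LipL}}$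 on it with values in $[0,\infty)$, such that: (i) every component $\mathcal I^{LipL}(X\times E;F)$ is a linear subspace of $LipL_0(X\times E;F)$, it is a Banach space under $\|\cdot\|_{\mathcal I^{LipL}}$, and $LipL(T)\le\|T\|_{\mathcal I^{LipL}}$ on it; (ii) it contains all maps $(x,e)\mapsto f(x)\,e^*(e)\,z$ with $f:X\to\mathbb R$ Lipschitz, $f(0)=0$, $e^*\in E^*$, $z\in F$; and the map $\mathbb R\times\mathbb R\to\mathbb R$, $(\alpha,\beta)\mapsto\alpha\beta$, has norm $1$; (iii) if $f:X\to X_0$ is Lipschitz with $f(0)=0$ and least Lipschitz constant $Lip(f)$, $v:E\to E_0$ and $u:F_0\to F$ are bounded linear operators, and $T\in\mathcal I^{LipL}(X_0\times E_0;F_0)$, then $u\circ T\circ(f,v)\in\mathcal I^{LipL}(X\times E;F)$ and $\|u\circ T\circ(f,v)\|_{\mathcal I^{LipL}}\le\|u\|\,\|T\|_{\mathcal I^{LipL}}\,Lip(f)\,\|v\|$. **Theorem.** Let $1<p\le\infty$. (a) For every pointed metric space $X$, all Banach spaces $E,F$ and every $T\in LipL_0(X\times E;F)$: $T\in\mathcal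 D_p^{LipL}(X\times E;F)$ if and only if $T^t\in\Pi_{p^*}(F^*;LipL_0(X\times E))$, and in this case $d_p^{LipL}(T)=\pi_{p^*}(T^t)$. (b) Consequently $\mathcal D_p^{LipL}(X\times E;F)=(\Pi_{p^*})^{LipL}_{dual}(X\times E;F)$ isometrically for all $X,E,F$, and $(\mathcal D_p^{LipL},d_p^{LipL})=\big((\Pi_{p^*})^{LipL}_{dual},\|\cdot\|_{(\Pi_{p^*})^{LipL}_{dual}}\big)$ is a Banach Lip-linear ideal. -/

import Mathlib

open scoped ENNReal

universe u v w

noncomputable section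

/-! Conventions: all Banach spaces are real. A pointed metric space is a type `X` with
`[MetricSpace X] [Zero X]`; the base point is `0 : X`. -/

section LipLinear

variable (X : Type u) [MetricSpace X] [Zero X]
variable (E : Type v) [NormedAddCommGroup E] [NormedSpace ℝ E]
variable (F : Type w) [NormedAddCommGroup F] [NormedSpace ℝ F]

/-- `IsLipLBound T C`: the constant `C` satisfies
`‖T(x,e) - T(y,e)‖ ≤ C d(x,y) ‖e‖` for all `x, y ∈ X`, `e ∈ E`. -/
def IsLipLBound {X : Type u} [MetricSpace X]
    {E : Type v} [NormedAddCommGroup E] [NormedSpace ℝ E]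
    {F : Type w} [NormedAddCommGroup F] [NormedSpace ℝ F]
    (T : X → E →ₗ[ℝ] F) (C : ℝ) : Prop :=
  ∀ (x y : X) (e : E), ‖T x e - T y e‖ ≤ C * dist x y * ‖e‖

/-- The vector space of Lip-linear operators `T : X × E → F` (written in curried form, each
`T x` being linear) with `T (0, e) = 0` for all `e`. -/
def lipLSubmodule : Submodule ℝ (X → E →ₗ[ℝ] F) where
  carrier := {T | (∃ C : ℝ, 0 ≤ C ∧ IsLipLBound T C) ∧ ∀ e : E, T 0 e = 0}
  add_mem' := by
    rintro S T ⟨⟨C, hC, hS⟩, hS0⟩ ⟨⟨D, hD, hT⟩, hT0⟩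
    refine ⟨⟨C + D, by positivity, fun x y e => ?_⟩, fun e => by simp [hS0, hT0]⟩
    have h : (S + T) x e - (S + T) y e = (S x e - S y e) + (T x e - T y e) := by
      simp only [Pi.add_apply, LinearMap.add_apply]; abel
    rw [h]
    calc _ ≤ ‖S x e - S y e‖ + ‖T x e - T y e‖ := norm_add_le _ _
      _ ≤ C * dist x y * ‖e‖ + D * dist x y * ‖e‖ := add_le_add (hS x y e) (hT x y e)
      _ = _ := by ring
  zero_mem' := ⟨⟨0, le_rfl, fun x y e => by simp⟩, fun e => by simp⟩
  smul_mem' := by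
    rintro c T ⟨⟨C, hC, hT⟩, hT0⟩
    refine ⟨⟨|c| * C, by positivity, fun x y e => ?_⟩, fun e => by simp [hT0]⟩
    have h : (c • T) x e - (c • T) y e = c • (T x e - T y e) := by
      simp [smul_sub]
    rw [h, norm_smul, Real.norm_eq_abs]
    calc |c| * ‖T x e - T y e‖ ≤ |c| * (C * dist x y * ‖e‖) :=
          mul_le_mul_of_nonneg_left (hT x y e) (abs_nonneg c)
      _ = _ := by ring

/-- The space `LipL₀(X × E; F)`. -/
def LipL0 : Type (max u v w) := lipLSubmodule X E F

instance : AddCommGroup (LipL0 X E F) := inferInstanceAs (AddCommGroup (lipLSubmodule X E F))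

instance : Module ℝ (LipL0 X E F) := inferInstanceAs (Module ℝ (lipLSubmodule X E F))

end LipLinear

namespace LipL0

section Basic

variable {X : Type u} [MetricSpace X] [Zero X]
variable {E : Type v} [NormedAddCommGroup E] [NormedSpace ℝ E]
variable {F : Type w} [NormedAddCommGroup F] [NormedSpace ℝ F]

/-- The value `T (x, e)`, linear in `e`. -/
def app (T : LipL0 X E F) (x : X) : E →ₗ[ℝ] F := T.1 x

/-- Constructor from a map, a Lipschitz bound, and vanishing at the base point. -/
def mk (T : X → E →ₗ[ℝ] F) (h : ∃ C : ℝ, 0 ≤ C ∧ IsLipLBound T C) (h0 : ∀ e, T 0 e = 0) :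
    LipL0 X E F := ⟨T, h, h0⟩

@[simp] theorem mk_app (T : X → E →ₗ[ℝ] F) (h : ∃ C : ℝ, 0 ≤ C ∧ IsLipLBound T C)
    (h0 : ∀ e, T 0 e = 0) (x : X) : (mk T h h0).app x = T x := rfl

@[simp] theorem app_base (T : LipL0 X E F) (e : E) : T.app 0 e = 0 := T.2.2 e

@[simp] theorem add_app (S T : LipL0 X E F) (x : X) (e : E) :
    (S + T).app x e = S.app x e + T.app x e := rfl

@[simp] theorem smul_app (c : ℝ) (T : LipL0 X E F) (x : X) (e : E) :
    (c • T).app x e = c • T.app x e := rfl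

@[simp] theorem zero_app (x : X) (e : E) : (0 : LipL0 X E F).app x e = 0 := rfl

@[simp] theorem sub_app (S T : LipL0 X E F) (x : X) (e : E) :
    (S - T).app x e = S.app x e - T.app x e := rfl

theorem ext_app {S T : LipL0 X E F} (h : ∀ x e, S.app x e = T.app x e) : S = T :=
  Subtype.ext (funext fun x => LinearMap.ext fun e => h x e)

/-- `LipL(T)`, the infimum of the constants `C` with
`‖T(x,e) - T(y,e)‖ ≤ C d(x,y) ‖e‖`. -/
instance : Norm (LipL0 X E F) := ⟨fun T => sInf {C : ℝ | 0 ≤ C ∧ IsLipLBound T.app C}⟩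

theorem norm_def (T : LipL0 X E F) : ‖T‖ = sInf {C : ℝ | 0 ≤ C ∧ IsLipLBound T.app C} := rfl

theorem bddBelow_bounds (T : LipL0 X E F) :
    BddBelow {C : ℝ | 0 ≤ C ∧ IsLipLBound T.app C} := ⟨0, fun _ hC => hC.1⟩

theorem norm_nonneg' (T : LipL0 X E F) : 0 ≤ ‖T‖ := Real.sInf_nonneg fun _ hC => hC.1

theorem norm_le_of_bound (T : LipL0 X E F) {C : ℝ} (hC : 0 ≤ C) (h : IsLipLBound T.app C) :
    ‖T‖ ≤ C := csInf_le T.bddBelow_bounds ⟨hC, h⟩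

theorem isLipLBound_norm (T : LipL0 X E F) : IsLipLBound T.app ‖T‖ := by
  intro x y e
  have hne : {C : ℝ | 0 ≤ C ∧ IsLipLBound T.app C}.Nonempty := T.2.1
  rcases (mul_nonneg (dist_nonneg (x := x) (y := y)) (norm_nonneg e)).eq_or_lt with h0 | h0
  · obtain ⟨C, -, hC⟩ := hne
    have := hC x y e
    rw [mul_assoc, ← h0, mul_zero] at this
    rw [mul_assoc, ← h0, mul_zero]
    exact this
  · rw [mul_assoc, ← div_le_iff₀ h0]
    refine le_csInf hne fun C hC => ?_
    rw [div_le_iff₀ h0, ← mul_assoc]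
    exact hC.2 x y e

theorem norm_app_le (T : LipL0 X E F) (x : X) (e : E) :
    ‖T.app x e‖ ≤ ‖T‖ * dist x 0 * ‖e‖ := by
  simpa using T.isLipLBound_norm x 0 e

theorem normCore : NormedSpace.Core ℝ (LipL0 X E F) where
  norm_nonneg := norm_nonneg'
  norm_smul := by
    have key : ∀ (c : ℝ) (T : LipL0 X E F), ‖c • T‖ ≤ ‖c‖ * ‖T‖ := fun c T =>
      norm_le_of_bound _ (mul_nonneg (norm_nonneg c) T.norm_nonneg') fun x y e => by
        rw [smul_app, smul_app, ← smul_sub, norm_smul, mul_assoc, mul_assoc, ← mul_assoc ‖T‖]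
        exact mul_le_mul_of_nonneg_left (T.isLipLBound_norm x y e) (norm_nonneg c)
    intro c T
    refine le_antisymm (key c T) ?_
    rcases eq_or_ne c 0 with rfl | hc
    · simpa using norm_nonneg' ((0 : ℝ) • T)
    · have h := key c⁻¹ (c • T)
      rw [smul_smul, inv_mul_cancel₀ hc, one_smul, norm_inv] at h
      have hc' : 0 < ‖c‖ := norm_pos_iff.2 hc
      calc ‖c‖ * ‖T‖ ≤ ‖c‖ * (‖c‖⁻¹ * ‖c • T‖) := mul_le_mul_of_nonneg_left h hc'.le
        _ = ‖c • T‖ := by rw [← mul_assoc, mul_inv_cancel₀ hc'.ne', one_mul]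
  norm_triangle := fun S T =>
    norm_le_of_bound _ (add_nonneg S.norm_nonneg' T.norm_nonneg') fun x y e => by
      rw [add_app, add_app, add_sub_add_comm, add_mul, add_mul]
      exact (norm_add_le _ _).trans
        (add_le_add (S.isLipLBound_norm x y e) (T.isLipLBound_norm x y e))
  norm_eq_zero_iff := by
    intro T
    constructor
    · intro h
      refine ext_app fun x e => ?_
      have := T.norm_app_le x e
      rw [h, zero_mul, zero_mul] at this
      simpa using this
    · rintro rfl
      exact le_antisymm (norm_le_of_bound _ le_rfl fun x y e => by simp) (norm_nonneg' _)

instance : NormedAddCommGroup (LipL0 X E F) := NormedAddCommGroup.ofCore normCore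

instance : NormedSpace ℝ (LipL0 X E F) := NormedSpace.ofCore normCore

/-- `LipL₀(X × E; F)` is a Banach space when `F` is one. -/
instance [CompleteSpace F] : CompleteSpace (LipL0 X E F) := by
  refine Metric.complete_of_cauchySeq_tendsto fun T hT => ?_
  have hpt : ∀ x e, ∃ l, Filter.Tendsto (fun n => (T n).app x e) Filter.atTop (nhds l) := by
    intro x e
    refine cauchySeq_tendsto_of_complete (Metric.cauchySeq_iff'.2 fun ε hε => ?_)
    set K : ℝ := dist x 0 * ‖e‖ + 1 with hK
    have hKpos : 0 < K := by positivity
    obtain ⟨N, hN⟩ := Metric.cauchySeq_iff'.1 hT (ε / K) (div_pos hε hKpos)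
    refine ⟨N, fun n hn => ?_⟩
    have h1 := hN n hn
    rw [dist_eq_norm] at h1 ⊢
    rw [← sub_app]
    calc ‖(T n - T N).app x e‖ ≤ ‖T n - T N‖ * dist x 0 * ‖e‖ := norm_app_le _ x e
      _ = ‖T n - T N‖ * (dist x 0 * ‖e‖) := by ring
      _ ≤ ‖T n - T N‖ * K := mul_le_mul_of_nonneg_left (by linarith) (norm_nonneg _)
      _ < ε / K * K := mul_lt_mul_of_pos_right h1 hKpos
      _ = ε := div_mul_cancel₀ _ hKpos.ne'
  choose L hL using hpt
  let L' : X → E →ₗ[ℝ] F := fun x =>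
    { toFun := L x
      map_add' := fun a b => tendsto_nhds_unique (hL x (a + b))
        (by simpa using (hL x a).add (hL x b))
      map_smul' := fun c a => tendsto_nhds_unique (hL x (c • a))
        (by simpa using (hL x a).const_smul c) }
  have hdiff : ∀ ε : ℝ, 0 < ε → ∃ N, ∀ n ≥ N, ∀ x y e,
      ‖((T n).app x e - L x e) - ((T n).app y e - L y e)‖ ≤ ε * dist x y * ‖e‖ := by
    intro ε hε
    obtain ⟨N, hN⟩ := Metric.cauchySeq_iff.1 hT ε hε
    refine ⟨N, fun n hn x y e => ?_⟩
    have hlim := (((hL x e).const_sub ((T n).app x e)).sub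
      ((hL y e).const_sub ((T n).app y e))).norm
    refine le_of_tendsto hlim (Filter.eventually_atTop.2 ⟨N, fun m hm => ?_⟩)
    have h1 := hN n hn m hm
    rw [dist_eq_norm] at h1
    refine ((T n - T m).isLipLBound_norm x y e).trans ?_
    gcongr
  obtain ⟨N, hN⟩ := hdiff 1 one_pos
  have hmem : ∃ C : ℝ, 0 ≤ C ∧ IsLipLBound L' C := by
    refine ⟨‖T N‖ + 1, by positivity, fun x y e => ?_⟩
    have h1 := hN N le_rfl x y e
    have h2 := (T N).isLipLBound_norm x y e
    have h3 : L' x e - L' y e = ((T N).app x e - (T N).app y e)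
        - (((T N).app x e - L x e) - ((T N).app y e - L y e)) := by
      change L x e - L y e = _
      abel
    rw [h3, add_mul, add_mul]
    exact (norm_sub_le _ _).trans (add_le_add h2 h1)
  have h0 : ∀ e, L' 0 e = 0 := fun e =>
    tendsto_nhds_unique (hL 0 e) (by simp)
  refine ⟨mk L' hmem h0, Metric.tendsto_atTop.2 fun ε hε => ?_⟩
  obtain ⟨M, hM⟩ := hdiff (ε / 2) (half_pos hε)
  refine ⟨M, fun n hn => ?_⟩
  rw [dist_eq_norm]
  exact (norm_le_of_bound _ (half_pos hε).le fun x y e => hM n hn x y e).trans_lt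
    (half_lt_self hε)

/-- The transpose `Tᵗ : F* → LipL₀(X × E)`, `Tᵗ(z*)(x, e) = ⟨z*, T(x, e)⟩`, as a bounded linear
operator. -/
def transpose (T : LipL0 X E F) : StrongDual ℝ F →L[ℝ] LipL0 X E ℝ :=
  LinearMap.mkContinuous
    { toFun := fun z => mk (fun x => (z : F →ₗ[ℝ] ℝ).comp (T.app x))
        ⟨‖z‖ * ‖T‖, by positivity, fun x y e => by
          simp only [LinearMap.comp_apply, ContinuousLinearMap.coe_coe]
          rw [← map_sub, mul_assoc, mul_assoc, ← mul_assoc ‖T‖]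
          exact (z.le_opNorm _).trans
            (mul_le_mul_of_nonneg_left (T.isLipLBound_norm x y e) (norm_nonneg z))⟩
        (fun e => by simp)
      map_add' := fun _ _ => ext_app fun _ _ => by simp
      map_smul' := fun _ _ => ext_app fun _ _ => by simp }
    ‖T‖ (fun z => by
      refine norm_le_of_bound _ (by positivity) fun x y e => ?_
      simp only [LinearMap.coe_mk, AddHom.coe_mk, mk_app, LinearMap.comp_apply,
        ContinuousLinearMap.coe_coe]
      rw [← map_sub, mul_comm ‖T‖, mul_assoc, mul_assoc, ← mul_assoc ‖T‖]
      exact (z.le_opNorm _).trans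
        (mul_le_mul_of_nonneg_left (T.isLipLBound_norm x y e) (norm_nonneg z)))

@[simp] theorem transpose_apply (T : LipL0 X E F) (z : StrongDual ℝ F) (x : X) (e : E) :
    (T.transpose z).app x e = z (T.app x e) := rfl

end Basic

end LipL0

section LipZero

/-- `Lip₀(X; Y)`: Lipschitz maps between pointed metric spaces preserving the base point. -/
structure Lip0 (X : Type u) [MetricSpace X] [Zero X] (Y : Type v) [MetricSpace Y] [Zero Y] where
  toFun : X → Y
  lipschitz' : ∃ C : ℝ, 0 ≤ C ∧ ∀ x y, dist (toFun x) (toFun y) ≤ C * dist x y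
  map_base' : toFun 0 = 0

/-- `Lip(f)`, the least Lipschitz constant of `f`. -/
def Lip0.lip {X : Type u} [MetricSpace X] [Zero X] {Y : Type v} [MetricSpace Y] [Zero Y]
    (f : Lip0 X Y) : ℝ :=
  sInf {C : ℝ | 0 ≤ C ∧ ∀ x y, dist (f.toFun x) (f.toFun y) ≤ C * dist x y}

end LipZero

namespace LipL0

/-- The operator `f · e* · z : (x, e) ↦ f(x) e*(e) z`, for `f ∈ X^#`, `e* ∈ E*`, `z ∈ F`. -/
def elementary {X : Type u} [MetricSpace X] [Zero X]
    {E : Type v} [NormedAddCommGroup E] [NormedSpace ℝ E]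
    {F : Type w} [NormedAddCommGroup F] [NormedSpace ℝ F]
    (f : Lip0 X ℝ) (φ : StrongDual ℝ E) (z : F) : LipL0 X E F :=
  mk (fun x => f.toFun x • (φ : E →ₗ[ℝ] ℝ).smulRight z)
    (by
      obtain ⟨C, hC, h⟩ := f.lipschitz'
      refine ⟨C * ‖φ‖ * ‖z‖, by positivity, fun x y e => ?_⟩
      simp only [LinearMap.smul_apply, LinearMap.smulRight_apply, ContinuousLinearMap.coe_coe]
      rw [← sub_smul, norm_smul, norm_smul, ← dist_eq_norm]
      calc dist (f.toFun x) (f.toFun y) * (‖φ e‖ * ‖z‖)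
          ≤ (C * dist x y) * (‖φ‖ * ‖e‖ * ‖z‖) :=
            mul_le_mul (h x y) (mul_le_mul_of_nonneg_right (φ.le_opNorm e) (norm_nonneg z))
              (by positivity) (by positivity)
        _ = _ := by ring)
    (fun e => by simp [f.map_base'])

@[simp] theorem elementary_app {X : Type u} [MetricSpace X] [Zero X]
    {E : Type v} [NormedAddCommGroup E] [NormedSpace ℝ E]
    {F : Type w} [NormedAddCommGroup F] [NormedSpace ℝ F]
    (f : Lip0 X ℝ) (φ : StrongDual ℝ E) (z : F) (x : X) (e : E) :
    (elementary f φ z).app x e = f.toFun x • φ e • z := rfl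

/-- The operator `u ∘ T ∘ (f, v) : (x, e) ↦ u (T (f x, v e))`. -/
def compose {X X₀ : Type u} [MetricSpace X] [Zero X] [MetricSpace X₀] [Zero X₀]
    {E E₀ : Type v} [NormedAddCommGroup E] [NormedSpace ℝ E]
    [NormedAddCommGroup E₀] [NormedSpace ℝ E₀]
    {F F₀ : Type w} [NormedAddCommGroup F] [NormedSpace ℝ F]
    [NormedAddCommGroup F₀] [NormedSpace ℝ F₀]
    (u : F₀ →L[ℝ] F) (T : LipL0 X₀ E₀ F₀) (f : Lip0 X X₀) (v : E →L[ℝ] E₀) : LipL0 X E F :=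
  mk (fun x => (u : F₀ →ₗ[ℝ] F).comp ((T.app (f.toFun x)).comp (v : E →ₗ[ℝ] E₀)))
    (by
      obtain ⟨C, hC, h⟩ := f.lipschitz'
      refine ⟨‖u‖ * ‖T‖ * C * ‖v‖, by positivity, fun x y e => ?_⟩
      simp only [LinearMap.comp_apply, ContinuousLinearMap.coe_coe]
      rw [← map_sub]
      calc _ ≤ ‖u‖ * ‖T.app (f.toFun x) (v e) - T.app (f.toFun y) (v e)‖ := u.le_opNorm _
        _ ≤ ‖u‖ * (‖T‖ * dist (f.toFun x) (f.toFun y) * ‖v e‖) := by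
            gcongr; exact T.isLipLBound_norm _ _ _
        _ ≤ ‖u‖ * (‖T‖ * (C * dist x y) * (‖v‖ * ‖e‖)) := by
            gcongr
            · exact h x y
            · exact v.le_opNorm e
        _ = _ := by ring)
    (fun e => by simp [f.map_base'])

@[simp] theorem compose_app {X X₀ : Type u} [MetricSpace X] [Zero X] [MetricSpace X₀] [Zero X₀]
    {E E₀ : Type v} [NormedAddCommGroup E] [NormedSpace ℝ E]
    [NormedAddCommGroup E₀] [NormedSpace ℝ E₀]
    {F F₀ : Type w} [NormedAddCommGroup F] [NormedSpace ℝ F]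
    [NormedAddCommGroup F₀] [NormedSpace ℝ F₀]
    (u : F₀ →L[ℝ] F) (T : LipL0 X₀ E₀ F₀) (f : Lip0 X X₀) (v : E →L[ℝ] E₀) (x : X) (e : E) :
    (compose u T f v).app x e = u (T.app (f.toFun x) (v e)) := rfl

/-- The operator `ℝ × ℝ → ℝ`, `(α, β) ↦ αβ` (each copy of `ℝ` being lifted to the universe
under consideration). -/
def idR2 : LipL0 (ULift.{u} ℝ) (ULift.{v} ℝ) (ULift.{w} ℝ) :=
  mk (fun α =>
      { toFun := fun β => ULift.up (α.down * β.down)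
        map_add' := fun a b => ULift.ext _ _ (mul_add _ _ _)
        map_smul' := fun c a => ULift.ext _ _ (mul_left_comm _ _ _) })
    ⟨1, zero_le_one, fun x y e => by
      change ‖x.down * e.down - y.down * e.down‖ ≤ 1 * dist x.down y.down * ‖e.down‖
      rw [← sub_mul, norm_mul, one_mul, dist_eq_norm]⟩
    (fun e => ULift.ext _ _ (zero_mul _))

end LipL0

section Summing

/-- The `ℓ_p` norm of a finite real sequence, `0 < p ≤ ∞`. -/
def lpNorm (p : ℝ≥0∞) {n : ℕ} (a : Fin n → ℝ) : ℝ :=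
  ‖(WithLp.toLp p a : PiLp p fun _ : Fin n => ℝ)‖

/-- The weak `ℓ_p` norm of `x₁, …, xₙ ∈ E`, i.e.
`sup_{φ ∈ B_{E*}} ‖(φ(x₁), …, φ(xₙ))‖_p`. -/
def weakLpNorm (p : ℝ≥0∞) {E : Type v} [NormedAddCommGroup E] [NormedSpace ℝ E]
    {n : ℕ} (x : Fin n → E) : ℝ :=
  ⨆ φ : Metric.closedBall (0 : StrongDual ℝ E) 1, lpNorm p (fun i => φ.1 (x i))

/-- `C` is a constant in the definition of a `p`-summing linear operator `u`. -/
def IsSummingBound (p : ℝ≥0∞) {E : Type v} [NormedAddCommGroup E] [NormedSpace ℝ E]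
    {F : Type w} [NormedAddCommGroup F] [NormedSpace ℝ F] (u : E →L[ℝ] F) (C : ℝ) : Prop :=
  0 ≤ C ∧ ∀ (n : ℕ) (x : Fin n → E), lpNorm p (fun i => ‖u (x i)‖) ≤ C * weakLpNorm p x

/-- `C` is a constant in the definition of a Cohen strongly `p`-summing Lip-linear operator:
`∑ |⟨T(xᵢ,eᵢ) - T(yᵢ,eᵢ), zᵢ*⟩| ≤ C ‖(d(xᵢ,yᵢ)‖eᵢ‖)ᵢ‖_p sup_{z** ∈ B_{F**}} ‖(z**(zᵢ*))ᵢ‖_{p*}`. -/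
def IsCohenBound (p : ℝ≥0∞) {X : Type u} [MetricSpace X] [Zero X]
    {E : Type v} [NormedAddCommGroup E] [NormedSpace ℝ E]
    {F : Type w} [NormedAddCommGroup F] [NormedSpace ℝ F] (T : LipL0 X E F) (C : ℝ) : Prop :=
  0 ≤ C ∧ ∀ (n : ℕ) (x y : Fin n → X) (e : Fin n → E) (z : Fin n → StrongDual ℝ F),
    ∑ i, |z i (T.app (x i) (e i) - T.app (y i) (e i))| ≤
      C * lpNorm p (fun i => dist (x i) (y i) * ‖e i‖) * weakLpNorm p.conjExponent z

end Summing

section Classes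

/-- A class of bounded linear operators between Banach spaces. -/
abbrev OperatorClass : Type (max (v + 1) (w + 1)) :=
  ∀ (E : Type v) (F : Type w) [NormedAddCommGroup E] [NormedSpace ℝ E] [CompleteSpace E]
    [NormedAddCommGroup F] [NormedSpace ℝ F] [CompleteSpace F], Set (E →L[ℝ] F)

/-- A real-valued function on bounded linear operators between Banach spaces. -/
abbrev OperatorNorm : Type (max (v + 1) (w + 1)) :=
  ∀ (E : Type v) (F : Type w) [NormedAddCommGroup E] [NormedSpace ℝ E] [CompleteSpace E]
    [NormedAddCommGroup F] [NormedSpace ℝ F] [CompleteSpace F], (E →L[ℝ] F) → ℝ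

/-- A class of Lip-linear operators. -/
abbrev LipLClass : Type (max (u + 1) (v + 1) (w + 1)) :=
  ∀ (X : Type u) (E : Type v) (F : Type w) [MetricSpace X] [Zero X]
    [NormedAddCommGroup E] [NormedSpace ℝ E] [CompleteSpace E]
    [NormedAddCommGroup F] [NormedSpace ℝ F] [CompleteSpace F], Set (LipL0 X E F)

/-- A real-valued function on Lip-linear operators. -/
abbrev LipLNorm : Type (max (u + 1) (v + 1) (w + 1)) :=
  ∀ (X : Type u) (E : Type v) (F : Type w) [MetricSpace X] [Zero X]
    [NormedAddCommGroup E] [NormedSpace ℝ E] [CompleteSpace E]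
    [NormedAddCommGroup F] [NormedSpace ℝ F] [CompleteSpace F], LipL0 X E F → ℝ

/-- The class `Π_p` of absolutely `p`-summing linear operators. -/
def summing (p : ℝ≥0∞) : OperatorClass.{v, w} := fun _ _ => {u | ∃ C, IsSummingBound p u C}

/-- The `p`-summing norm `π_p`. -/
def summingNorm (p : ℝ≥0∞) : OperatorNorm.{v, w} := fun _ _ _ _ _ _ _ _ u =>
  sInf {C | IsSummingBound p u C}

/-- The class `𝒟_p^{LipL}` of Cohen strongly `p`-summing Lip-linear operators. -/
def cohen (p : ℝ≥0∞) : LipLClass.{u, v, w} := fun _ _ _ => {T | ∃ C, IsCohenBound p T C}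

/-- The norm `d_p^{LipL}`. -/
def cohenNorm (p : ℝ≥0∞) : LipLNorm.{u, v, w} := fun _ _ _ _ _ _ _ _ _ _ _ T =>
  sInf {C | IsCohenBound p T C}

/-- `ℐ^{LipL}_{dual}`: the Lip-linear operators whose transpose `F* → LipL₀(X × E)` is in `ℐ`. -/
def dualLipL (I : OperatorClass.{w, max u v}) : LipLClass.{u, v, w} := fun X E F =>
  {T | T.transpose ∈ I (StrongDual ℝ F) (LipL0 X E ℝ)}

/-- The norm of `ℐ^{LipL}_{dual}`, `T ↦ ‖Tᵗ‖_ℐ`. -/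
def dualLipLNorm (N : OperatorNorm.{w, max u v}) : LipLNorm.{u, v, w} :=
  fun X E F _ _ _ _ _ _ _ _ T => N (StrongDual ℝ F) (LipL0 X E ℝ) T.transpose

/-- `I` is a Lip-linear ideal. -/
structure IsLipLIdeal (I : LipLClass.{u, v, w}) : Prop where
  zero_mem : ∀ (X : Type u) (E : Type v) (F : Type w) [MetricSpace X] [Zero X]
    [NormedAddCommGroup E] [NormedSpace ℝ E] [CompleteSpace E]
    [NormedAddCommGroup F] [NormedSpace ℝ F] [CompleteSpace F], (0 : LipL0 X E F) ∈ I X E F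
  add_mem : ∀ (X : Type u) (E : Type v) (F : Type w) [MetricSpace X] [Zero X]
    [NormedAddCommGroup E] [NormedSpace ℝ E] [CompleteSpace E]
    [NormedAddCommGroup F] [NormedSpace ℝ F] [CompleteSpace F] (S T : LipL0 X E F),
    S ∈ I X E F → T ∈ I X E F → S + T ∈ I X E F
  smul_mem : ∀ (X : Type u) (E : Type v) (F : Type w) [MetricSpace X] [Zero X]
    [NormedAddCommGroup E] [NormedSpace ℝ E] [CompleteSpace E]
    [NormedAddCommGroup F] [NormedSpace ℝ F] [CompleteSpace F] (c : ℝ) (T : LipL0 X E F),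
    T ∈ I X E F → c • T ∈ I X E F
  elementary_mem : ∀ (X : Type u) (E : Type v) (F : Type w) [MetricSpace X] [Zero X]
    [NormedAddCommGroup E] [NormedSpace ℝ E] [CompleteSpace E]
    [NormedAddCommGroup F] [NormedSpace ℝ F] [CompleteSpace F]
    (f : Lip0 X ℝ) (φ : StrongDual ℝ E) (z : F), LipL0.elementary f φ z ∈ I X E F
  compose_mem : ∀ (X X₀ : Type u) (E E₀ : Type v) (F F₀ : Type w)
    [MetricSpace X] [Zero X] [MetricSpace X₀] [Zero X₀]
    [NormedAddCommGroup E] [NormedSpace ℝ E] [CompleteSpace E]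
    [NormedAddCommGroup E₀] [NormedSpace ℝ E₀] [CompleteSpace E₀]
    [NormedAddCommGroup F] [NormedSpace ℝ F] [CompleteSpace F]
    [NormedAddCommGroup F₀] [NormedSpace ℝ F₀] [CompleteSpace F₀]
    (f : Lip0 X X₀) (v : E →L[ℝ] E₀) (T : LipL0 X₀ E₀ F₀) (u : F₀ →L[ℝ] F),
    T ∈ I X₀ E₀ F₀ → LipL0.compose u T f v ∈ I X E F

/-- `(I, N)` is a Banach Lip-linear ideal. On each component `N` is a complete norm dominating
`LipL(·)`; definiteness of `N` is part of `norm_eq_zero`. -/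
structure IsBanachLipLIdeal (I : LipLClass.{u, v, w}) (N : LipLNorm.{u, v, w}) : Prop
    extends IsLipLIdeal I where
  norm_nonneg : ∀ (X : Type u) (E : Type v) (F : Type w) [MetricSpace X] [Zero X]
    [NormedAddCommGroup E] [NormedSpace ℝ E] [CompleteSpace E]
    [NormedAddCommGroup F] [NormedSpace ℝ F] [CompleteSpace F],
    ∀ T ∈ I X E F, 0 ≤ N X E F T
  norm_eq_zero : ∀ (X : Type u) (E : Type v) (F : Type w) [MetricSpace X] [Zero X]
    [NormedAddCommGroup E] [NormedSpace ℝ E] [CompleteSpace E]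
    [NormedAddCommGroup F] [NormedSpace ℝ F] [CompleteSpace F],
    ∀ T ∈ I X E F, (N X E F T = 0 ↔ T = 0)
  norm_add_le : ∀ (X : Type u) (E : Type v) (F : Type w) [MetricSpace X] [Zero X]
    [NormedAddCommGroup E] [NormedSpace ℝ E] [CompleteSpace E]
    [NormedAddCommGroup F] [NormedSpace ℝ F] [CompleteSpace F],
    ∀ S ∈ I X E F, ∀ T ∈ I X E F, N X E F (S + T) ≤ N X E F S + N X E F T
  norm_smul : ∀ (X : Type u) (E : Type v) (F : Type w) [MetricSpace X] [Zero X]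
    [NormedAddCommGroup E] [NormedSpace ℝ E] [CompleteSpace E]
    [NormedAddCommGroup F] [NormedSpace ℝ F] [CompleteSpace F] (c : ℝ),
    ∀ T ∈ I X E F, N X E F (c • T) = |c| * N X E F T
  complete : ∀ (X : Type u) (E : Type v) (F : Type w) [MetricSpace X] [Zero X]
    [NormedAddCommGroup E] [NormedSpace ℝ E] [CompleteSpace E]
    [NormedAddCommGroup F] [NormedSpace ℝ F] [CompleteSpace F] (T : ℕ → LipL0 X E F),
    (∀ n, T n ∈ I X E F) →
    (∀ ε : ℝ, 0 < ε → ∃ k, ∀ m ≥ k, ∀ n ≥ k, N X E F (T m - T n) < ε) →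
    ∃ S ∈ I X E F, Filter.Tendsto (fun n => N X E F (T n - S)) Filter.atTop (nhds 0)
  lipL_le_norm : ∀ (X : Type u) (E : Type v) (F : Type w) [MetricSpace X] [Zero X]
    [NormedAddCommGroup E] [NormedSpace ℝ E] [CompleteSpace E]
    [NormedAddCommGroup F] [NormedSpace ℝ F] [CompleteSpace F],
    ∀ T ∈ I X E F, ‖T‖ ≤ N X E F T
  norm_idR2 : N (ULift.{u} ℝ) (ULift.{v} ℝ) (ULift.{w} ℝ) LipL0.idR2 = 1
  norm_compose_le : ∀ (X X₀ : Type u) (E E₀ : Type v) (F F₀ : Type w)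
    [MetricSpace X] [Zero X] [MetricSpace X₀] [Zero X₀]
    [NormedAddCommGroup E] [NormedSpace ℝ E] [CompleteSpace E]
    [NormedAddCommGroup E₀] [NormedSpace ℝ E₀] [CompleteSpace E₀]
    [NormedAddCommGroup F] [NormedSpace ℝ F] [CompleteSpace F]
    [NormedAddCommGroup F₀] [NormedSpace ℝ F₀] [CompleteSpace F₀]
    (f : Lip0 X X₀) (v : E →L[ℝ] E₀) (T : LipL0 X₀ E₀ F₀) (u : F₀ →L[ℝ] F),
    T ∈ I X₀ E₀ F₀ →
      N X E F (LipL0.compose u T f v) ≤ ‖u‖ * N X₀ E₀ F₀ T * f.lip * ‖v‖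

end Classes

end

/-! The norm of the scalar operator `T.transpose z` is the supremum of |z(T(x,e) - T(y,e))| over
d(x,y)‖e‖ ≤ 1. The Cohen inequality for T and the summing inequality for its transpose are therefore
dual to each other under the pairing of ℓ_p with ℓ_{p*}, with the same constant C. Hölder's
inequality gives summing ⇒ Cohen (`IsSummingBound.isCohenBound`). For the converse
(`IsCohenBound.isSummingBound`), a sequence a in the ℓ_p ball norms (‖T.transpose zᵢ‖)ᵢ, and
linearity in e allows almost norming points with d(xᵢ,yᵢ)‖eᵢ‖ ≤ aᵢ.

Since the two sets of admissible constants coincide, so do the classes and the infima. The ideal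
axioms are checked on the Cohen side, first for individual constants; the infimum is attained
(`isCohenBound_cohenNorm`), which turns these statements into statements about the norm.
Completeness combines ‖T‖ ≤ d_p(T), completeness of `LipL0`, and stability of Cohen bounds under
pointwise limits. -/

theorem ENNReal.one_le_conjExponent (p : ℝ≥0∞) : 1 ≤ p.conjExponent := le_self_add

theorem ENNReal.conjExponent_top : (∞ : ℝ≥0∞).conjExponent = 1 := by
  simp [ENNReal.conjExponent]

theorem ENNReal.holderConjugate_toReal_conjExponent {p : ℝ≥0∞} (hp : 1 < p) (hp' : p ≠ ∞) :
    p.toReal.HolderConjugate p.conjExponent.toReal := by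
  lift p to NNReal using hp'
  have h1 : 1 < p := by exact_mod_cast hp
  rw [← ENNReal.coe_conjExponent h1, ENNReal.coe_toReal, ENNReal.coe_toReal]
  exact NNReal.holderConjugate_coe_iff.2 (NNReal.HolderConjugate.conjExponent h1)

/-! ### Finite ℓ_p norms and Hölder duality. -/

section LpNorm

theorem lpNorm_top {n : ℕ} (a : Fin n → ℝ) : lpNorm ∞ a = ⨆ i, |a i| := rfl

theorem lpNorm_one {n : ℕ} (a : Fin n → ℝ) : lpNorm 1 a = ∑ i, |a i| := by
  rw [lpNorm, PiLp.norm_eq_sum (by simp)]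
  simp

theorem lpNorm_eq_sum {p : ℝ≥0∞} (hp : 0 < p.toReal) {n : ℕ} (a : Fin n → ℝ) :
    lpNorm p a = (∑ i, |a i| ^ p.toReal) ^ (1 / p.toReal) :=
  PiLp.norm_eq_sum hp _

theorem lpNorm_nonneg {p : ℝ≥0∞} (hp : 1 ≤ p) {n : ℕ} (a : Fin n → ℝ) : 0 ≤ lpNorm p a := by
  have : Fact (1 ≤ p) := ⟨hp⟩
  exact norm_nonneg _

theorem lpNorm_smul {p : ℝ≥0∞} (hp : 1 ≤ p) {n : ℕ} (c : ℝ) (a : Fin n → ℝ) :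
    lpNorm p (fun i => c * a i) = |c| * lpNorm p a := by
  have : Fact (1 ≤ p) := ⟨hp⟩
  exact norm_smul c (WithLp.toLp p a : PiLp p fun _ : Fin n => ℝ)

theorem abs_le_lpNorm_top {n : ℕ} (a : Fin n → ℝ) (i : Fin n) : |a i| ≤ lpNorm ∞ a :=
  le_ciSup (f := fun i => |a i|) (Set.finite_range _).bddAbove i

theorem lpNorm_mono {p : ℝ≥0∞} (hp : 1 ≤ p) {n : ℕ} {a b : Fin n → ℝ}
    (h : ∀ i, |a i| ≤ |b i|) : lpNorm p a ≤ lpNorm p b := by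
  rcases eq_or_ne p ∞ with rfl | hp'
  · exact Real.iSup_le (fun i => (h i).trans (abs_le_lpNorm_top b i)) (lpNorm_nonneg hp b)
  · have h0 : 0 < p.toReal := ENNReal.toReal_pos (one_pos.trans_le hp).ne' hp'
    rw [lpNorm_eq_sum h0, lpNorm_eq_sum h0]
    gcongr (∑ i, ?_ ^ _) ^ _ with i
    exact h i

theorem lpNorm_fin_one {p : ℝ≥0∞} (hp : 1 ≤ p) (a : Fin 1 → ℝ) : lpNorm p a = |a 0| := by
  rcases eq_or_ne p ∞ with rfl | hp'
  · simp [lpNorm_top]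
  · have h0 : 0 < p.toReal := ENNReal.toReal_pos (one_pos.trans_le hp).ne' hp'
    rw [lpNorm_eq_sum h0, Fin.sum_univ_one, one_div, Real.rpow_rpow_inv (abs_nonneg _) h0.ne']

/-- **Hölder's inequality** for finite sequences. -/
theorem sum_abs_mul_abs_le_lpNorm_mul_lpNorm {p : ℝ≥0∞} (hp : 1 < p) {n : ℕ}
    (a b : Fin n → ℝ) :
    ∑ i, |a i| * |b i| ≤ lpNorm p a * lpNorm p.conjExponent b := by
  rcases eq_or_ne p ∞ with rfl | hp'
  · rw [ENNReal.conjExponent_top, lpNorm_one, Finset.mul_sum]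
    gcongr with i
    exact abs_le_lpNorm_top a i
  · have h := ENNReal.holderConjugate_toReal_conjExponent hp hp'
    rw [lpNorm_eq_sum h.pos, lpNorm_eq_sum h.symm.pos]
    simpa using Real.inner_le_Lp_mul_Lq Finset.univ (fun i => |a i|) (fun i => |b i|) h

/-- Hölder's inequality is sharp. -/
theorem exists_sum_mul_abs_eq_lpNorm {p : ℝ≥0∞} (hp : 1 < p) {n : ℕ} (b : Fin n → ℝ) :
    ∃ a : Fin n → ℝ, (∀ i, 0 ≤ a i) ∧ lpNorm p a ≤ 1 ∧
      ∑ i, a i * |b i| = lpNorm p.conjExponent b := by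
  rcases eq_or_ne p ∞ with rfl | hp'
  -- For p = ∞ the conjugate norm is the ℓ_1 norm, which the constant sequence 1 norms.
  · refine ⟨fun _ => 1, fun _ => zero_le_one, ?_, ?_⟩
    · exact Real.iSup_le (fun i => by simp) zero_le_one
    · simp [ENNReal.conjExponent_top, lpNorm_one]
  · have h := ENNReal.holderConjugate_toReal_conjExponent hp hp'
    -- The ℓ_{p*} norm of b is a maximum, not only a supremum, over the ℓ_p ball; `h.symm` puts b on
    -- the p* side.
    obtain ⟨g, hg, hgb⟩ :=
      (NNReal.isGreatest_Lp Finset.univ (fun i => ‖b i‖₊) h.symm).1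
    refine ⟨fun i => g i, fun i => (g i).2, ?_, ?_⟩
    · rw [lpNorm_eq_sum h.pos]
      refine Real.rpow_le_one (by positivity) ?_ (by have := h.pos; positivity)
      have hg' : ∑ i, g i ^ p.toReal ≤ 1 := hg
      simpa using (NNReal.coe_le_coe.2 hg')
    · rw [lpNorm_eq_sum h.symm.pos]
      have := congrArg NNReal.toReal hgb
      push_cast at this
      simpa [mul_comm] using this

end LpNorm

/-! ### Weak ℓ_p norms. -/

section WeakLpNorm

variable {E : Type v} [NormedAddCommGroup E] [NormedSpace ℝ E] {n : ℕ}

theorem weakLpNorm_nonneg {p : ℝ≥0∞} (hp : 1 ≤ p) (x : Fin n → E) : 0 ≤ weakLpNorm p x :=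
  Real.iSup_nonneg fun _ => lpNorm_nonneg hp _

theorem lpNorm_apply_le_lpNorm_norm {p : ℝ≥0∞} (hp : 1 ≤ p) (x : Fin n → E)
    {φ : StrongDual ℝ E} (hφ : ‖φ‖ ≤ 1) :
    lpNorm p (fun i => φ (x i)) ≤ lpNorm p (fun i => ‖x i‖) :=
  lpNorm_mono hp fun i => by
    rw [abs_norm]
    exact (φ.le_opNorm (x i)).trans (mul_le_of_le_one_left (norm_nonneg _) hφ)

theorem weakLpNorm_le_lpNorm_norm {p : ℝ≥0∞} (hp : 1 ≤ p) (x : Fin n → E) :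
    weakLpNorm p x ≤ lpNorm p (fun i => ‖x i‖) :=
  Real.iSup_le (fun φ => lpNorm_apply_le_lpNorm_norm hp x (mem_closedBall_zero_iff.1 φ.2))
    (lpNorm_nonneg hp _)

theorem lpNorm_apply_le_weakLpNorm {p : ℝ≥0∞} (hp : 1 ≤ p) (x : Fin n → E)
    {φ : StrongDual ℝ E} (hφ : ‖φ‖ ≤ 1) : lpNorm p (fun i => φ (x i)) ≤ weakLpNorm p x := by
  refine le_ciSup (f := fun ψ : Metric.closedBall (0 : StrongDual ℝ E) 1 =>
    lpNorm p (fun i => ψ.1 (x i))) ⟨lpNorm p (fun i => ‖x i‖), ?_⟩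
    ⟨φ, mem_closedBall_zero_iff.2 hφ⟩
  rintro _ ⟨ψ, rfl⟩
  exact lpNorm_apply_le_lpNorm_norm hp x (mem_closedBall_zero_iff.1 ψ.2)

theorem lpNorm_apply_le_norm_mul_weakLpNorm {p : ℝ≥0∞} (hp : 1 ≤ p) (x : Fin n → E)
    (φ : StrongDual ℝ E) : lpNorm p (fun i => φ (x i)) ≤ ‖φ‖ * weakLpNorm p x := by
  rcases eq_or_ne φ 0 with rfl | hφ
  -- Homogeneity with factor 0 shows that the zero sequence has norm 0; φ = 0 cannot be normalised.
  · have := lpNorm_smul hp 0 (fun i => ‖x i‖)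
    simp only [zero_mul, abs_zero] at this
    simp [this]
  · have h0 : 0 < ‖φ‖ := norm_pos_iff.2 hφ
    have h1 := lpNorm_apply_le_weakLpNorm hp x (φ := ‖φ‖⁻¹ • φ)
      (by rw [norm_smul, norm_inv, norm_norm, inv_mul_cancel₀ h0.ne'])
    simp only [smul_apply, smul_eq_mul] at h1
    rwa [lpNorm_smul hp, abs_of_pos (inv_pos.2 h0), inv_mul_le_iff₀ h0] at h1

/-- The weak norm of functionals is a supremum over the bidual, and evaluation at y is a bidual
element of norm at most ‖y‖. -/
theorem lpNorm_dual_apply_le {F : Type w} [NormedAddCommGroup F] [NormedSpace ℝ F]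
    {p : ℝ≥0∞} (hp : 1 ≤ p) (z : Fin n → StrongDual ℝ F) (y : F) :
    lpNorm p (fun i => z i y) ≤ ‖y‖ * weakLpNorm p z :=
  (lpNorm_apply_le_norm_mul_weakLpNorm hp z
    (NormedSpace.inclusionInDoubleDual ℝ F y)).trans (by
      gcongr
      · exact weakLpNorm_nonneg hp z
      · exact NormedSpace.double_dual_bound ℝ F y)

/-- Each φ ∘ A with ‖φ‖ ≤ 1 is a functional of norm at most ‖A‖. It is applied below to the adjoint
of the left factor of a composition. -/
theorem weakLpNorm_map_le {F : Type w} [NormedAddCommGroup F] [NormedSpace ℝ F]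
    {p : ℝ≥0∞} (hp : 1 ≤ p) (A : E →L[ℝ] F) (x : Fin n → E) :
    weakLpNorm p (fun i => A (x i)) ≤ ‖A‖ * weakLpNorm p x := by
  refine Real.iSup_le (fun φ => ?_) (mul_nonneg (norm_nonneg _) (weakLpNorm_nonneg hp x))
  refine (lpNorm_apply_le_norm_mul_weakLpNorm hp x (φ.1.comp A)).trans ?_
  gcongr
  · exact weakLpNorm_nonneg hp x
  · exact (φ.1.opNorm_comp_le A).trans
      (mul_le_of_le_one_left (norm_nonneg _) (mem_closedBall_zero_iff.1 φ.2))

end WeakLpNorm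

/-! ### Lipschitz constants and almost norming points. -/

section Bounds

variable {X : Type u} [MetricSpace X] [Zero X]
variable {E : Type v} [NormedAddCommGroup E] [NormedSpace ℝ E]
variable {F : Type w} [NormedAddCommGroup F] [NormedSpace ℝ F]

/-- The least Lipschitz constant is a Lipschitz constant. -/
theorem Lip0.dist_le {Y : Type v} [MetricSpace Y] [Zero Y] (f : Lip0 X Y) (x y : X) :
    dist (f.toFun x) (f.toFun y) ≤ f.lip * dist x y := by
  rcases (dist_nonneg (x := x) (y := y)).eq_or_lt with h0 | h0
  · obtain ⟨C, -, hC⟩ := f.lipschitz'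
    simpa [← h0] using hC x y
  · rw [← div_le_iff₀ h0]
    exact le_csInf f.lipschitz' fun C hC => (div_le_iff₀ h0).2 (hC.2 x y)

theorem Lip0.lip_nonneg {Y : Type v} [MetricSpace Y] [Zero Y] (f : Lip0 X Y) : 0 ≤ f.lip :=
  Real.sInf_nonneg fun _ hC => hC.1

namespace LipL0

/-- Up to a factor `r < 1`, a scalar Lip-linear operator attains its norm at points `x, y, e`
with `d(x, y) ‖e‖` at most a prescribed number `a`. -/
theorem exists_mul_norm_le_abs (S : LipL0 X E ℝ) {a r : ℝ} (ha : 0 ≤ a) (hr0 : 0 ≤ r)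
    (hr : r < 1) : ∃ (x y : X) (e : E), dist x y * ‖e‖ ≤ a ∧
      r * (a * ‖S‖) ≤ |S.app x e - S.app y e| := by
  rcases eq_or_ne S 0 with rfl | hS
  -- When X or E is trivial no triple has d(x,y)‖e‖ = a > 0, which is why only ≤ a is claimed.
  · exact ⟨0, 0, 0, by simpa using ha, by simp⟩
  have hpos : 0 < ‖S‖ := norm_pos_iff.2 hS
  -- The norm is the least bound, so the smaller number r‖S‖ must fail at some triple.
  have hnb : ¬ IsLipLBound S.app (r * ‖S‖) := fun h =>
    absurd (S.norm_le_of_bound (by positivity) h)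
      (not_le.2 (mul_lt_of_lt_one_left hpos hr))
  simp only [IsLipLBound, not_forall, not_le] at hnb
  obtain ⟨x, y, e, h⟩ := hnb
  have hd : 0 < dist x y * ‖e‖ := by
    refine lt_of_le_of_ne (by positivity) fun h0 => ?_
    have h1 := S.isLipLBound_norm x y e
    rw [mul_assoc, ← h0, mul_zero] at h h1
    exact absurd h (not_lt.2 h1)
  -- Rescaling e makes d(x,y)‖e‖ exactly a and, by linearity in e, scales the increment of S by the
  -- same factor.
  refine ⟨x, y, (a / (dist x y * ‖e‖)) • e, ?_, ?_⟩
  · rw [norm_smul, Real.norm_of_nonneg (by positivity), mul_left_comm, div_mul_cancel₀ _ hd.ne']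
  · rw [map_smul, map_smul, ← smul_sub, smul_eq_mul, abs_mul, abs_of_nonneg (by positivity)]
    rw [Real.norm_eq_abs] at h
    calc r * (a * ‖S‖) = a / (dist x y * ‖e‖) * (r * ‖S‖ * dist x y * ‖e‖) := by
          rw [mul_assoc (r * ‖S‖), mul_comm (r * ‖S‖), ← mul_assoc (a / _),
            div_mul_cancel₀ _ hd.ne']
          ring
      _ ≤ _ := by gcongr

end LipL0

/-! ### Cohen bounds for T against summing bounds for its transpose. -/

variable {p : ℝ≥0∞}

/-- Each summand is at most d(xᵢ,yᵢ)‖eᵢ‖ · ‖T.transpose zᵢ‖; Hölder's inequality separates the two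
factors. -/
theorem IsSummingBound.isCohenBound (hp : 1 < p) {T : LipL0 X E F} {C : ℝ}
    (h : IsSummingBound p.conjExponent T.transpose C) : IsCohenBound p T C := by
  refine ⟨h.1, fun n x y e z => ?_⟩
  calc ∑ i, |z i (T.app (x i) (e i) - T.app (y i) (e i))|
      ≤ ∑ i, |dist (x i) (y i) * ‖e i‖| * |‖T.transpose (z i)‖| := by
        refine Finset.sum_le_sum fun i _ => ?_
        rw [abs_norm, abs_of_nonneg (by positivity : 0 ≤ dist (x i) (y i) * ‖e i‖), map_sub,
          mul_comm, ← mul_assoc]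
        exact (T.transpose (z i)).isLipLBound_norm (x i) (y i) (e i)
    _ ≤ lpNorm p (fun i => dist (x i) (y i) * ‖e i‖) *
          lpNorm p.conjExponent (fun i => ‖T.transpose (z i)‖) :=
        sum_abs_mul_abs_le_lpNorm_mul_lpNorm hp _ _
    _ ≤ lpNorm p (fun i => dist (x i) (y i) * ‖e i‖) * (C * weakLpNorm p.conjExponent z) :=
        mul_le_mul_of_nonneg_left (h.2 n z) (lpNorm_nonneg hp.le _)
    _ = _ := by ring

/-- Duality rewrites the ℓ_{p*} norm as a sum weighted by a, and the weights are absorbed into the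
vectors eᵢ before the Cohen inequality is applied. -/
theorem IsCohenBound.isSummingBound (hp : 1 < p) {T : LipL0 X E F} {C : ℝ}
    (h : IsCohenBound p T C) : IsSummingBound p.conjExponent T.transpose C := by
  refine ⟨h.1, fun n z => ?_⟩
  have hW := weakLpNorm_nonneg p.one_le_conjExponent z
  obtain ⟨a, ha0, ha1, ha⟩ :=
    exists_sum_mul_abs_eq_lpNorm hp (fun i => ‖T.transpose (z i)‖)
  simp only [abs_norm] at ha
  rw [← ha]
  -- The norms of the `T.transpose (z i)` need not be attained: a factor r < 1 is lost and recovered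
  -- by letting r increase to 1.
  refine le_of_tendsto (f := fun r : ℝ => r * ∑ i, a i * ‖T.transpose (z i)‖)
    (x := nhdsWithin 1 (Set.Iio 1)) ?_ ?_
  · simpa using (Filter.tendsto_id.mono_left (nhdsWithin_le_nhds (a := (1 : ℝ)))).mul_const
      (∑ i, a i * ‖T.transpose (z i)‖)
  filter_upwards [Ioo_mem_nhdsLT (zero_lt_one (α := ℝ))] with r ⟨hr0', hr⟩
  have hr0 := hr0'.le
  choose x y e hd hS using fun i => (T.transpose (z i)).exists_mul_norm_le_abs (ha0 i) hr0 hr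
  calc r * ∑ i, a i * ‖T.transpose (z i)‖
      ≤ ∑ i, |z i (T.app (x i) (e i) - T.app (y i) (e i))| := by
        rw [Finset.mul_sum]
        gcongr with i
        rw [map_sub]
        exact hS i
    _ ≤ C * lpNorm p (fun i => dist (x i) (y i) * ‖e i‖) * weakLpNorm p.conjExponent z :=
        h.2 n x y e z
    _ ≤ C * 1 * weakLpNorm p.conjExponent z := by
        gcongr
        · exact h.1
        · refine (lpNorm_mono hp.le fun i => ?_).trans ha1
          rw [abs_of_nonneg (by positivity), abs_of_nonneg (ha0 i)]
          exact hd i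
    _ = _ := by ring

theorem isCohenBound_iff_isSummingBound_transpose (hp : 1 < p) {T : LipL0 X E F} {C : ℝ} :
    IsCohenBound p T C ↔ IsSummingBound p.conjExponent T.transpose C :=
  ⟨fun h => h.isSummingBound hp, fun h => h.isCohenBound hp⟩

/-! ### Stability of Cohen bounds under the ideal operations and limits. -/

namespace IsCohenBound

variable {S T : LipL0 X E F} {C D : ℝ}

theorem zero : IsCohenBound p (0 : LipL0 X E F) 0 := ⟨le_rfl, fun n x y e z => by simp⟩

theorem add (hS : IsCohenBound p S C) (hT : IsCohenBound p T D) :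
    IsCohenBound p (S + T) (C + D) := by
  refine ⟨add_nonneg hS.1 hT.1, fun n x y e z => ?_⟩
  rw [add_mul, add_mul]
  refine le_trans ?_ (add_le_add (hS.2 n x y e z) (hT.2 n x y e z))
  rw [← Finset.sum_add_distrib]
  gcongr with i
  rw [LipL0.add_app, LipL0.add_app, add_sub_add_comm, map_add]
  exact abs_add_le _ _

theorem smul (c : ℝ) (hT : IsCohenBound p T C) : IsCohenBound p (c • T) (|c| * C) := by
  refine ⟨mul_nonneg (abs_nonneg c) hT.1, fun n x y e z => ?_⟩
  simp only [LipL0.smul_app, ← smul_sub, map_smul, smul_eq_mul, abs_mul]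
  rw [← Finset.mul_sum, mul_assoc |c|, mul_assoc |c|]
  exact mul_le_mul_of_nonneg_left (hT.2 n x y e z) (abs_nonneg c)

/-- An operator whose increments are dominated by those of a rank-one operator is Cohen strongly
`p`-summing. -/
theorem of_abs_le (hp : 1 < p) {K : ℝ} (hK : 0 ≤ K) (y₀ : F)
    (h : ∀ (x y : X) (e : E) (z : StrongDual ℝ F),
      |z (T.app x e - T.app y e)| ≤ K * (dist x y * ‖e‖) * |z y₀|) :
    IsCohenBound p T (K * ‖y₀‖) := by
  refine ⟨mul_nonneg hK (norm_nonneg _), fun n x y e z => ?_⟩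
  calc ∑ i, |z i (T.app (x i) (e i) - T.app (y i) (e i))|
      ≤ ∑ i, K * (|dist (x i) (y i) * ‖e i‖| * |z i y₀|) := by
        gcongr with i
        rw [← mul_assoc, abs_of_nonneg (by positivity : 0 ≤ dist (x i) (y i) * ‖e i‖)]
        exact h _ _ _ _
    _ = K * ∑ i, |dist (x i) (y i) * ‖e i‖| * |z i y₀| := by rw [Finset.mul_sum]
    _ ≤ K * (lpNorm p (fun i => dist (x i) (y i) * ‖e i‖) *
          lpNorm p.conjExponent (fun i => z i y₀)) :=
        mul_le_mul_of_nonneg_left (sum_abs_mul_abs_le_lpNorm_mul_lpNorm hp _ _) hK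
    _ ≤ K * (lpNorm p (fun i => dist (x i) (y i) * ‖e i‖) *
          (‖y₀‖ * weakLpNorm p.conjExponent z)) := by
        gcongr
        · exact lpNorm_nonneg hp.le _
        · exact lpNorm_dual_apply_le p.one_le_conjExponent z y₀
    _ = _ := by ring

theorem elementary (hp : 1 < p) (f : Lip0 X ℝ) (φ : StrongDual ℝ E) (z : F) :
    IsCohenBound p (LipL0.elementary f φ z) (f.lip * ‖φ‖ * ‖z‖) := by
  refine of_abs_le hp (mul_nonneg f.lip_nonneg (norm_nonneg φ)) z fun x y e ζ => ?_
  rw [LipL0.elementary_app, LipL0.elementary_app, ← sub_smul, map_smul, map_smul, smul_eq_mul,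
    smul_eq_mul, ← mul_assoc, abs_mul, abs_mul]
  refine mul_le_mul_of_nonneg_right ?_ (abs_nonneg _)
  calc |f.toFun x - f.toFun y| * |φ e| ≤ (f.lip * dist x y) * (‖φ‖ * ‖e‖) := by
        gcongr
        · exact mul_nonneg f.lip_nonneg dist_nonneg
        · exact f.dist_le x y
        · exact φ.le_opNorm e
    _ = _ := by ring

theorem idR2 (hp : 1 < p) :
    IsCohenBound p (LipL0.idR2 : LipL0 (ULift.{u} ℝ) (ULift.{v} ℝ) (ULift.{w} ℝ)) 1 := by
  have h1 : ‖ULift.up.{w} (1 : ℝ)‖ = 1 := norm_one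
  have := of_abs_le (T := (LipL0.idR2 : LipL0 (ULift.{u} ℝ) (ULift.{v} ℝ) (ULift.{w} ℝ)))
    hp zero_le_one (ULift.up 1) fun x y e z => by
    have hxy : LipL0.idR2.app x e - LipL0.idR2.app y e
        = ((x.down - y.down) * e.down) • ULift.up.{w} (1 : ℝ) :=
      ULift.ext _ _ (by
        change x.down * e.down - y.down * e.down = (x.down - y.down) * e.down * 1
        ring)
    rw [hxy, map_smul, smul_eq_mul, abs_mul, abs_mul, one_mul]
    rfl
  rwa [h1, one_mul] at this

theorem compose {X₀ : Type u} [MetricSpace X₀] [Zero X₀]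
    {E₀ : Type v} [NormedAddCommGroup E₀] [NormedSpace ℝ E₀]
    {F₀ : Type w} [NormedAddCommGroup F₀] [NormedSpace ℝ F₀] (hp : 1 < p)
    (u : F₀ →L[ℝ] F) {T : LipL0 X₀ E₀ F₀} (hT : IsCohenBound p T C) (f : Lip0 X X₀)
    (v : E →L[ℝ] E₀) : IsCohenBound p (LipL0.compose u T f v) (‖u‖ * C * f.lip * ‖v‖) := by
  have hf := f.lip_nonneg
  have hC := hT.1
  refine ⟨by positivity, fun n x y e z => ?_⟩
  calc ∑ i, |z i ((LipL0.compose u T f v).app (x i) (e i)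
          - (LipL0.compose u T f v).app (y i) (e i))|
      = ∑ i, |(z i).comp u (T.app (f.toFun (x i)) (v (e i))
          - T.app (f.toFun (y i)) (v (e i)))| := by simp
    _ ≤ C * lpNorm p (fun i => dist (f.toFun (x i)) (f.toFun (y i)) * ‖v (e i)‖) *
          weakLpNorm p.conjExponent (fun i => (z i).comp u) := hT.2 n _ _ _ _
    _ ≤ C * ((f.lip * ‖v‖) * lpNorm p (fun i => dist (x i) (y i) * ‖e i‖)) *
          (‖u‖ * weakLpNorm p.conjExponent z) := by
        have h0 := lpNorm_nonneg hp.le fun i => dist (x i) (y i) * ‖e i‖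
        gcongr
        · exact weakLpNorm_nonneg p.one_le_conjExponent _
        · have h1 := lpNorm_smul hp.le (f.lip * ‖v‖) fun i => dist (x i) (y i) * ‖e i‖
          rw [abs_of_nonneg (by positivity)] at h1
          rw [← h1]
          refine lpNorm_mono hp.le fun i => ?_
          rw [abs_of_nonneg (by positivity), abs_of_nonneg (by positivity)]
          calc _ ≤ (f.lip * dist (x i) (y i)) * (‖v‖ * ‖e i‖) := by
                gcongr
                · exact f.dist_le _ _
                · exact v.le_opNorm _
            _ = _ := by ring
        -- A is the adjoint ζ ↦ ζ ∘ u, which carries the functionals zᵢ to the zᵢ ∘ u at the cost of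
        -- ‖u‖.
        · let A : StrongDual ℝ F →L[ℝ] StrongDual ℝ F₀ :=
            (ContinuousLinearMap.compL ℝ F₀ F ℝ).flip u
          have hA : ‖A‖ ≤ ‖u‖ := by
            refine A.opNorm_le_bound (norm_nonneg u) fun ζ => ?_
            rw [mul_comm]
            exact ζ.opNorm_comp_le u
          exact (weakLpNorm_map_le p.one_le_conjExponent A z).trans
            (mul_le_mul_of_nonneg_right hA (weakLpNorm_nonneg p.one_le_conjExponent z))
    _ = _ := by ring

/-- The Cohen inequality for one-term sequences bounds |z(T(x,e) - T(y,e))| by C d(x,y)‖e‖‖z‖, and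
functionals recover the norm in F. -/
theorem norm_le (hp : 1 < p) (hT : IsCohenBound p T C) : ‖T‖ ≤ C := by
  refine T.norm_le_of_bound hT.1 fun x y e => ?_
  refine NormedSpace.norm_le_dual_bound ℝ _
    (mul_nonneg (mul_nonneg hT.1 dist_nonneg) (norm_nonneg e)) fun z => ?_
  have h := hT.2 1 (fun _ => x) (fun _ => y) (fun _ => e) (fun _ => z)
  have hz := weakLpNorm_le_lpNorm_norm p.one_le_conjExponent (fun _ : Fin 1 => z)
  rw [lpNorm_fin_one p.one_le_conjExponent, abs_norm] at hz
  rw [lpNorm_fin_one hp.le, abs_of_nonneg (by positivity : 0 ≤ dist x y * ‖e‖), Fin.sum_univ_one,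
    ← mul_assoc] at h
  refine h.trans (mul_le_mul_of_nonneg_left hz ?_)
  exact mul_nonneg (mul_nonneg hT.1 dist_nonneg) (norm_nonneg e)

/-- Cohen bounds pass to pointwise limits. -/
theorem of_tendsto {U : ℕ → LipL0 X E F} (hT : ∀ x e, Filter.Tendsto (fun n => (U n).app x e)
    Filter.atTop (nhds (T.app x e))) (hU : ∀ᶠ n in Filter.atTop, IsCohenBound p (U n) C) :
    IsCohenBound p T C := by
  obtain ⟨k, hk⟩ := hU.exists
  refine ⟨hk.1, fun n x y e z => ?_⟩
  refine le_of_tendsto (tendsto_finsetSum _ fun i _ =>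
    (((z i).continuous.tendsto _).comp ((hT (x i) (e i)).sub (hT (y i) (e i)))).abs) ?_
  filter_upwards [hU] with m hm
  exact hm.2 n x y e z

end IsCohenBound

theorem LipL0.tendsto_app {U : ℕ → LipL0 X E F} {T : LipL0 X E F}
    (h : Filter.Tendsto U Filter.atTop (nhds T)) (x : X) (e : E) :
    Filter.Tendsto (fun n => (U n).app x e) Filter.atTop (nhds (T.app x e)) := by
  rw [tendsto_iff_norm_sub_tendsto_zero] at h ⊢
  have h1 : Filter.Tendsto (fun n => ‖U n - T‖ * dist x 0 * ‖e‖) Filter.atTop (nhds 0) := by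
    simpa using (h.mul_const (dist x 0)).mul_const ‖e‖
  exact squeeze_zero (fun _ => norm_nonneg _) (fun n => (U n - T).norm_app_le x e) h1

end Bounds

/-! ### The Cohen norm and its completeness. -/

section CohenNorm

variable {X : Type u} [MetricSpace X] [Zero X]
variable {E : Type v} [NormedAddCommGroup E] [NormedSpace ℝ E] [CompleteSpace E]
variable {F : Type w} [NormedAddCommGroup F] [NormedSpace ℝ F] [CompleteSpace F]
variable {p : ℝ≥0∞} {T : LipL0 X E F} {C : ℝ}

theorem cohenNorm_nonneg : 0 ≤ cohenNorm p X E F T := Real.sInf_nonneg fun _ hC => hC.1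

theorem IsCohenBound.cohenNorm_le (hT : IsCohenBound p T C) : cohenNorm p X E F T ≤ C :=
  csInf_le ⟨0, fun _ hC => hC.1⟩ hT

/-- The infimum defining the Cohen norm is attained. -/
theorem isCohenBound_cohenNorm (hT : T ∈ cohen p X E F) :
    IsCohenBound p T (cohenNorm p X E F T) := by
  -- Every condition on C is a non-strict inequality between continuous functions of C.
  have hclosed : IsClosed {C | IsCohenBound p T C} := by
    simp only [IsCohenBound, Set.ofPred_and, Set.ofPred_forall]
    refine isClosed_Ici.inter (isClosed_iInter fun n => isClosed_iInter fun x =>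
      isClosed_iInter fun y => isClosed_iInter fun e => isClosed_iInter fun z => ?_)
    exact isClosed_le continuous_const
      ((continuous_id.mul continuous_const).mul continuous_const)
  exact hclosed.csInf_mem hT ⟨0, fun _ hC => hC.1⟩

theorem norm_le_cohenNorm (hp : 1 < p) (hT : T ∈ cohen p X E F) :
    ‖T‖ ≤ cohenNorm p X E F T := (isCohenBound_cohenNorm hT).norm_le hp

theorem cohenNorm_smul (c : ℝ) (hT : T ∈ cohen p X E F) :
    cohenNorm p X E F (c • T) = |c| * cohenNorm p X E F T := by
  have hb := (isCohenBound_cohenNorm hT).smul c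
  refine le_antisymm hb.cohenNorm_le ?_
  rcases eq_or_ne c 0 with rfl | hc
  · simpa using cohenNorm_nonneg
  -- The reverse inequality is the upper bound applied to c • T with the scalar c⁻¹.
  have h := ((isCohenBound_cohenNorm ⟨_, hb⟩).smul c⁻¹).cohenNorm_le
  rwa [smul_smul, inv_mul_cancel₀ hc, one_smul, abs_inv, ← div_eq_inv_mul,
    le_div_iff₀' (abs_pos.2 hc)] at h

/-- The Cohen norm dominates the `LipL0` norm, so a limit S exists there; pointwise limits of Cohen
bounds then upgrade the convergence to the Cohen norm. -/
theorem exists_tendsto_cohenNorm (hp : 1 < p) (U : ℕ → LipL0 X E F)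
    (hU : ∀ n, U n ∈ cohen p X E F)
    (hc : ∀ ε : ℝ, 0 < ε → ∃ k, ∀ m ≥ k, ∀ n ≥ k, cohenNorm p X E F (U m - U n) < ε) :
    ∃ S ∈ cohen p X E F,
      Filter.Tendsto (fun n => cohenNorm p X E F (U n - S)) Filter.atTop (nhds 0) := by
  have hsub : ∀ m n, U m - U n ∈ cohen p X E F := fun m n => by
    obtain ⟨C, hC⟩ := hU m
    obtain ⟨D, hD⟩ := hU n
    rw [sub_eq_add_neg, ← neg_one_smul ℝ (U n)]
    exact ⟨_, hC.add (hD.smul _)⟩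
  have hcau : CauchySeq U := Metric.cauchySeq_iff.2 fun ε hε => by
    obtain ⟨k, hk⟩ := hc ε hε
    refine ⟨k, fun m hm n hn => ?_⟩
    rw [dist_eq_norm]
    exact (norm_le_cohenNorm hp (hsub m n)).trans_lt (hk m hm n hn)
  obtain ⟨S, hS⟩ := cauchySeq_tendsto_of_complete hcau
  have hlim : ∀ ε : ℝ, 0 < ε → ∃ k, ∀ m ≥ k, IsCohenBound p (U m - S) ε := by
    intro ε hε
    obtain ⟨k, hk⟩ := hc ε hε
    -- With m fixed, n tends to infinity; the bound ε is uniform for n ≥ k.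
    refine ⟨k, fun m hm => IsCohenBound.of_tendsto (U := fun n => U m - U n)
      (LipL0.tendsto_app (hS.const_sub (U m))) ?_⟩
    filter_upwards [Filter.eventually_ge_atTop k] with n hn
    have hb := isCohenBound_cohenNorm (hsub m n)
    refine ⟨hε.le, fun j x y e z => (hb.2 j x y e z).trans ?_⟩
    gcongr
    · exact weakLpNorm_nonneg p.one_le_conjExponent z
    · exact lpNorm_nonneg hp.le _
    · exact (hk m hm n hn).le
  refine ⟨S, ?_, Metric.tendsto_atTop.2 fun ε hε => ?_⟩
  · obtain ⟨k, hk⟩ := hlim 1 one_pos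
    obtain ⟨C, hC⟩ := hU k
    -- S = U k - (U k - S), and both terms have Cohen bounds.
    have h := hC.add ((hk k le_rfl).smul (-1))
    rw [neg_one_smul, neg_sub, add_sub_cancel] at h
    exact ⟨_, h⟩
  · obtain ⟨k, hk⟩ := hlim (ε / 2) (half_pos hε)
    refine ⟨k, fun m hm => ?_⟩
    rw [Real.dist_0_eq_abs, abs_of_nonneg cohenNorm_nonneg]
    exact (hk m hm).cohenNorm_le.trans_lt (half_lt_self hε)

end CohenNorm

/-! ### The ideal axioms and the transfer to the dual class. -/

theorem LipL0.one_le_norm_idR2 :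
    1 ≤ ‖(LipL0.idR2 : LipL0 (ULift.{u} ℝ) (ULift.{v} ℝ) (ULift.{w} ℝ))‖ := by
  -- At x = 1, y = 0, e = 1 the increment, the distance and ‖e‖ all equal 1.
  have h := LipL0.idR2.{u, v, w}.isLipLBound_norm (ULift.up 1) (ULift.up 0) (ULift.up 1)
  have h1 : LipL0.idR2.{u, v, w}.app (ULift.up 1) (ULift.up 1)
      - LipL0.idR2.{u, v, w}.app (ULift.up 0) (ULift.up 1) = ULift.up 1 :=
    ULift.ext _ _ (by change (1 : ℝ) * 1 - 0 * 1 = 1; norm_num)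
  have h2 : ‖ULift.up.{w} (1 : ℝ)‖ = 1 := norm_one
  have h3 : ‖ULift.up.{v} (1 : ℝ)‖ = 1 := norm_one
  have h4 : dist (ULift.up.{u} (1 : ℝ)) (ULift.up 0) = 1 := by
    change dist (1 : ℝ) 0 = 1
    simp
  rwa [h1, h2, h3, h4, mul_one, mul_one] at h

theorem isBanachLipLIdeal_cohen {p : ℝ≥0∞} (hp : 1 < p) :
    IsBanachLipLIdeal.{u, v, w} (cohen p) (cohenNorm p) where
  zero_mem X E F := ⟨0, .zero⟩
  add_mem X E F := by
    intros
    rename_i hS hT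
    obtain ⟨C, hC⟩ := hS
    obtain ⟨D, hD⟩ := hT
    exact ⟨_, hC.add hD⟩
  smul_mem X E F := by
    intros
    rename_i c T hT
    obtain ⟨C, hC⟩ := hT
    exact ⟨_, hC.smul c⟩
  elementary_mem X E F := by
    intros
    exact ⟨_, .elementary hp _ _ _⟩
  compose_mem X X₀ E E₀ F F₀ := by
    intros
    rename_i f v T u hT
    obtain ⟨C, hC⟩ := hT
    exact ⟨_, hC.compose hp u f v⟩
  norm_nonneg X E F := by
    intros
    exact cohenNorm_nonneg
  norm_eq_zero X E F := by
    intros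
    rename_i T hT
    refine ⟨fun h => ?_, ?_⟩
    · exact norm_le_zero_iff.1 (h ▸ norm_le_cohenNorm hp hT)
    · rintro rfl
      exact le_antisymm IsCohenBound.zero.cohenNorm_le cohenNorm_nonneg
  norm_add_le X E F := by
    intros
    rename_i S hS T hT
    exact ((isCohenBound_cohenNorm hS).add (isCohenBound_cohenNorm hT)).cohenNorm_le
  norm_smul X E F := by
    intros
    rename_i c T hT
    exact cohenNorm_smul c hT
  complete X E F := by
    intros
    rename_i U hU hc
    exact exists_tendsto_cohenNorm hp U hU hc
  lipL_le_norm X E F := by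
    intros
    rename_i T hT
    exact norm_le_cohenNorm hp hT
  norm_idR2 :=
    le_antisymm (IsCohenBound.idR2 hp).cohenNorm_le
      (LipL0.one_le_norm_idR2.trans (norm_le_cohenNorm hp ⟨_, .idR2 hp⟩))
  norm_compose_le X X₀ E E₀ F F₀ := by
    intros
    rename_i f v T u hT
    exact ((isCohenBound_cohenNorm hT).compose hp u f v).cohenNorm_le

theorem cohen_eq_dualLipL_summing {p : ℝ≥0∞} (hp : 1 < p) :
    cohen.{u, v, w} p = dualLipL (summing p.conjExponent) := by
  funext X E F _ _ _ _ _ _ _ _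
  exact Set.ext fun T => exists_congr fun C => isCohenBound_iff_isSummingBound_transpose hp

/-- Both infima run over the same set, even when it is empty. The norms therefore agree as functions
on all operators, and the ideal structure can be transported by rewriting. -/
theorem cohenNorm_eq_dualLipLNorm_summingNorm {p : ℝ≥0∞} (hp : 1 < p) :
    cohenNorm.{u, v, w} p = dualLipLNorm (summingNorm p.conjExponent) := by
  funext X E F _ _ _ _ _ _ _ _ T
  exact congrArg sInf (Set.ext fun C => isCohenBound_iff_isSummingBound_transpose hp)

theorem mainTheorem7 (p : ℝ≥0∞) (hp : 1 < p) :
    (∀ (X : Type u) (E : Type v) (F : Type w) [MetricSpace X] [Zero X]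
      [NormedAddCommGroup E] [NormedSpace ℝ E] [CompleteSpace E]
      [NormedAddCommGroup F] [NormedSpace ℝ F] [CompleteSpace F] (T : LipL0 X E F),
      (T ∈ cohen p X E F ↔
        T.transpose ∈ summing p.conjExponent (StrongDual ℝ F) (LipL0 X E ℝ)) ∧
      (T ∈ cohen p X E F →
        cohenNorm p X E F T =
          summingNorm p.conjExponent (StrongDual ℝ F) (LipL0 X E ℝ) T.transpose)) ∧
    (∀ (X : Type u) (E : Type v) (F : Type w) [MetricSpace X] [Zero X]
      [NormedAddCommGroup E] [NormedSpace ℝ E] [CompleteSpace E]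
      [NormedAddCommGroup F] [NormedSpace ℝ F] [CompleteSpace F],
      cohen p X E F = dualLipL (summing p.conjExponent) X E F ∧
      ∀ T ∈ cohen p X E F,
        cohenNorm p X E F T = dualLipLNorm (summingNorm p.conjExponent) X E F T) ∧
    IsBanachLipLIdeal.{u, v, w} (cohen p) (cohenNorm p) ∧
    IsBanachLipLIdeal.{u, v, w} (dualLipL (summing p.conjExponent))
      (dualLipLNorm (summingNorm p.conjExponent)) := by
  have hI := cohen_eq_dualLipL_summing.{u, v, w} hp
  have hN := cohenNorm_eq_dualLipLNorm_summingNorm.{u, v, w} hp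
  have hB := isBanachLipLIdeal_cohen.{u, v, w} hp
  refine ⟨fun X E F => ?_, fun X E F => ?_, hB, ?_⟩
  · intro _ _ _ _ _ _ _ _ T
    exact ⟨exists_congr fun C => isCohenBound_iff_isSummingBound_transpose hp,
      fun _ => by rw [hN]; rfl⟩
  · intro _ _ _ _ _ _ _ _
    exact ⟨by rw [hI], fun T _ => by rw [hN]⟩
  · rwa [hI, hN] at hB
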